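/- Let $X$ be a complex Banach space and let $Q$ be a quasinilpotent bounded linear operator on $X$, i.e. $\sigma(Q)=\{0\}$. Define $$\mathcal B_Q=\{z\in\mathbb C:\ \sup_{j\ge 1}\|(I+zQ)^j\|<\infty\},\qquad \mathcal A_Q=\{z\in\mathbb C:\ \limsup_{s\to+\infty}\|(I-szQ)^{-1}\|<\infty\},$$ $$\mathcal T_Q=\{z\in\mathbb C:\ \limsup_{j\to\infty}\,(j+1)\|zQ(I+zQ)^j\|<\infty\}.$$ Then $\overline{\mathcal B_Q}\subset\mathcal A_Q$. Moreover, if $Q\neq 0$, then $\partial\mathcal B_Q\cap\mathcal T_Q=\{0\}$. -/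

import Mathlib

open Filter Topology
open scoped ENNReal

namespace Microspectral

variable {X : Type*} [NormedAddCommGroup X] [NormedSpace ℂ X]

/-- A bounded operator is quasinilpotent if its spectrum is `{0}`. -/
def IsQuasinilpotent (Q : X →L[ℂ] X) : Prop :=
  spectrum ℂ Q = {0}

/-- The power-bounded set `B_Q`: all `z` such that the powers `(1 + zQ)^j`, `j ≥ 1`, are bounded
in operator norm by a constant that may depend on `z`. -/
def powerBoundedSet (Q : X →L[ℂ] X) : Set ℂ :=
  {z | ∃ N : ℝ, ∀ j : ℕ, 1 ≤ j → ‖(1 + z • Q) ^ j‖ ≤ N}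

/-- The Abel set of order `k`: all `z` with `limsup_{s → +∞} ‖(1 - s z Q)^{-k}‖ < ∞`, the limsup
being taken in `[0, ∞]`. For quasinilpotent `Q` every `1 - s z Q` is invertible, so that
`Ring.inverse` is the genuine inverse. -/
noncomputable def abelSetOfOrder (Q : X →L[ℂ] X) (k : ℕ) : Set ℂ :=
  {z | limsup (fun s : ℝ =>
      ENNReal.ofReal ‖(Ring.inverse (1 - ((s : ℂ) * z) • Q : X →L[ℂ] X)) ^ k‖) atTop < ∞}

/-- The Abel set `A_Q`, that is, the Abel set of order one. -/
noncomputable def abelSet (Q : X →L[ℂ] X) : Set ℂ :=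
  abelSetOfOrder Q 1

/-- The Tauberian set with exponent `α`: all `z` with
`limsup_{j → ∞} (j + 1)^α ‖zQ (1 + zQ)^j‖ < ∞`, the limsup being taken in `[0, ∞]`. -/
noncomputable def tauberianSetOfExponent (Q : X →L[ℂ] X) (α : ℝ) : Set ℂ :=
  {z | limsup (fun j : ℕ =>
      ENNReal.ofReal (((j : ℝ) + 1) ^ α * ‖(z • Q) * (1 + z • Q) ^ j‖)) atTop < ∞}

/-- The Tauberian set `T_Q`, with exponent one. -/
noncomputable def tauberianSet (Q : X →L[ℂ] X) : Set ℂ :=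
  tauberianSetOfExponent Q 1

end Microspectral

namespace Microspectral

section NormedRing

variable {A : Type*} [NormedRing A]

lemma norm_pow_sub_pow_le {T : A} {C : ℝ} (hT : ∀ j : ℕ, ‖(T - 1) * T ^ j‖ ≤ C / (j + 1))
    {m n : ℕ} (hmn : m ≤ n) : ‖T ^ n - T ^ m‖ ≤ ∑ j ∈ Finset.Ico m n, C / ((j : ℝ) + 1) := by
  rw [← Finset.sum_Ico_sub (fun j => T ^ j) hmn]
  refine (norm_sum_le _ _).trans (Finset.sum_le_sum fun j _ => ?_)
  have : T ^ (j + 1) - T ^ j = (T - 1) * T ^ j := by rw [sub_mul, pow_succ', one_mul]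
  rw [this]
  exact hT j

/-- Mixed estimate for an element satisfying the Ritt condition `‖(T - 1) T ^ j‖ = O(1 / j)`. -/
lemma choose_mul_norm_sub_one_pow_mul_pow_le {T : A} {M C : ℝ} (hM : ∀ n : ℕ, ‖T ^ n‖ ≤ M)
    (hT : ∀ j : ℕ, ‖(T - 1) * T ^ j‖ ≤ C / (j + 1)) {n k : ℕ} (hkn : k ≤ n) :
    (n.choose k : ℝ) * ‖(T - 1) ^ k * T ^ (n - k)‖ ≤ M * (2 * C * Real.exp 1) ^ k := by
  have hC : 0 ≤ C := by simpa using (norm_nonneg _).trans (hT 0)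
  have hM0 : 0 ≤ M := (norm_nonneg _).trans (hM 0)
  rcases Nat.eq_zero_or_pos k with rfl | hk
  · simpa using hM n
  obtain ⟨m, hm⟩ : ∃ m, n / k = m + 1 :=
    ⟨n / k - 1, (Nat.succ_pred_eq_of_pos (Nat.div_pos hkn hk)).symm⟩
  have hle : k * (m + 1) ≤ n := hm ▸ Nat.mul_div_le n k
  have hlt : n < k * (m + 1) + k := by
    have := Nat.lt_mul_div_succ n hk
    rw [hm] at this
    linarith
  have hk0 : (0 : ℝ) < k := by exact_mod_cast hk
  have hn0 : (0 : ℝ) < n := by exact_mod_cast hk.trans_le hkn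
  have hcomm : Commute (T - 1) (T ^ m) :=
    ((Commute.refl T).sub_left (Commute.one_left T)).pow_right m
  have hsplit : (T - 1) ^ k * T ^ (n - k) = ((T - 1) * T ^ m) ^ k * T ^ (n - k * (m + 1)) := by
    rw [hcomm.mul_pow, mul_assoc, ← pow_mul, ← pow_add]
    congr 2
    have : k * (m + 1) = m * k + k := by ring
    omega
  have hCm : C / ((m : ℝ) + 1) ≤ 2 * C * k / n := by
    rw [div_le_div_iff₀ (by positivity) hn0]
    have h1 : (n : ℝ) ≤ 2 * k * (m + 1) := by
      have : n ≤ 2 * k * (m + 1) := by nlinarith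
      exact_mod_cast this
    nlinarith
  have hnorm : ‖(T - 1) ^ k * T ^ (n - k)‖ ≤ (2 * C * k / n) ^ k * M := by
    rw [hsplit]
    refine (norm_mul_le _ _).trans (mul_le_mul ?_ (hM _) (norm_nonneg _) (by positivity))
    exact (norm_pow_le' _ hk).trans (pow_le_pow_left₀ (norm_nonneg _) ((hT m).trans hCm) k)
  have hchoose : (n.choose k : ℝ) ≤ (n : ℝ) ^ k / k.factorial := Nat.choose_le_pow_div k n
  have hexp : (k : ℝ) ^ k / k.factorial ≤ Real.exp 1 ^ k := by
    rw [← Real.exp_nat_mul, mul_one]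
    exact Real.pow_div_factorial_le_exp _ hk0.le k
  calc (n.choose k : ℝ) * ‖(T - 1) ^ k * T ^ (n - k)‖
      ≤ (n : ℝ) ^ k / k.factorial * ((2 * C * k / n) ^ k * M) :=
        mul_le_mul hchoose hnorm (norm_nonneg _) (by positivity)
    _ = M * ((2 * C) ^ k * ((k : ℝ) ^ k / k.factorial)) := by
        rw [div_pow, mul_pow]
        field_simp
    _ ≤ M * ((2 * C) ^ k * Real.exp 1 ^ k) := by gcongr
    _ = _ := by rw [mul_pow (2 * C)]

end NormedRing

section NormedAlgebra

variable {A : Type*} [NormedRing A] [NormedAlgebra ℂ A]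

/-- Neumann series bound for the resolvent of a power bounded element. -/
lemma norm_le_of_one_sub_smul_mul_eq_one [CompleteSpace A] {T S : A} {N : ℝ}
    (hT : ∀ n : ℕ, ‖T ^ n‖ ≤ N) {u : ℂ} (hu : ‖u‖ < 1) (hS : (1 - u • T) * S = 1) :
    ‖S‖ ≤ N * (1 - ‖u‖)⁻¹ := by
  have hb : ∀ n : ℕ, ‖(u • T) ^ n‖ ≤ N * ‖u‖ ^ n := fun n => by
    rw [smul_pow, norm_smul, norm_pow, mul_comm]
    exact mul_le_mul_of_nonneg_right (hT n) (by positivity)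
  have hg : HasSum (fun n : ℕ => N * ‖u‖ ^ n) (N * (1 - ‖u‖)⁻¹) :=
    (hasSum_geometric_of_lt_one (norm_nonneg u) hu).mul_left N
  have hs : Summable fun n : ℕ => (u • T) ^ n := hg.summable.of_norm_bounded hb
  have h1 : (∑' n : ℕ, (u • T) ^ n) * (1 - u • T) = 1 := hs.tsum_pow_mul_one_sub
  have h2 : S = ∑' n : ℕ, (u • T) ^ n := (left_inv_eq_right_inv h1 hS).symm
  rw [h2]
  exact tsum_of_norm_bounded hg hb

/-- If `1 + P` is power bounded, then `(1 - s P)⁻¹` is bounded on every sector around the positive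
real axis with opening less than `π`. -/
lemma norm_inverse_one_sub_smul_le [CompleteSpace A] {P : A} {N K : ℝ}
    (hP : ∀ n : ℕ, ‖(1 + P) ^ n‖ ≤ N) (hK : 1 ≤ K) {s : ℂ} (hs : ‖s‖ ≤ K * s.re)
    (hu : IsUnit (1 - s • P)) : ‖Ring.inverse (1 - s • P)‖ ≤ N * K := by
  have hx : 0 ≤ s.re := by nlinarith [norm_nonneg s]
  have hsq : ‖1 + s‖ ^ 2 = ‖s‖ ^ 2 + (1 + 2 * s.re) := by
    rw [← Complex.normSq_eq_norm_sq, ← Complex.normSq_eq_norm_sq, Complex.normSq_apply,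
      Complex.normSq_apply]
    simp
    ring
  have htri : ‖1 + s‖ ≤ 1 + ‖s‖ := (norm_add_le _ _).trans (by simp)
  have hlt : ‖s‖ < ‖1 + s‖ := lt_of_pow_lt_pow_left₀ 2 (norm_nonneg _) (by linarith)
  have hpos : 0 < ‖1 + s‖ := (norm_nonneg s).trans_lt hlt
  have hne : 1 + s ≠ 0 := norm_pos_iff.1 hpos
  have hgap : 1 ≤ K * (‖1 + s‖ - ‖s‖) := by
    have h1 : ‖1 + s‖ + ‖s‖ ≤ K * (‖1 + s‖ - ‖s‖) * (‖1 + s‖ + ‖s‖) := by nlinarith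
    have h2 : 0 < ‖1 + s‖ + ‖s‖ := by linarith [norm_nonneg s]
    exact le_of_mul_le_mul_right (by linarith) h2
  have hN : 0 ≤ N := (norm_nonneg _).trans (hP 0)
  have hnu : ‖s / (1 + s)‖ < 1 := by rw [norm_div, div_lt_one hpos]; exact hlt
  have hfac : 1 - (s / (1 + s)) • (1 + P) = (1 + s)⁻¹ • (1 - s • P) := by
    have h1 : (1 : A) = ((1 + s)⁻¹ * (1 + s)) • (1 : A) := by
      rw [inv_mul_cancel₀ hne, one_smul]
    rw [div_eq_inv_mul, mul_smul]
    nth_rewrite 1 [h1]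
    rw [mul_smul, ← smul_sub]
    congr 1
    rw [add_smul, smul_add, one_smul]
    abel
  have hS : (1 - (s / (1 + s)) • (1 + P)) * ((1 + s) • Ring.inverse (1 - s • P)) = 1 := by
    rw [hfac, smul_mul_smul_comm, inv_mul_cancel₀ hne, one_smul, Ring.mul_inverse_cancel _ hu]
  have h := norm_le_of_one_sub_smul_mul_eq_one hP hnu hS
  rw [norm_smul, norm_div] at h
  have h3 : (1 - ‖s‖ / ‖1 + s‖)⁻¹ ≤ K * ‖1 + s‖ := by
    have h4 : 1 - ‖s‖ / ‖1 + s‖ = (‖1 + s‖ - ‖s‖) / ‖1 + s‖ := by field_simp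
    rw [h4, inv_div, div_le_iff₀ (by linarith)]
    nlinarith
  have h5 : ‖1 + s‖ * ‖Ring.inverse (1 - s • P)‖ ≤ ‖1 + s‖ * (N * K) := by
    calc _ ≤ _ := h
      _ ≤ N * (K * ‖1 + s‖) := mul_le_mul_of_nonneg_left h3 hN
      _ = _ := by ring
  exact le_of_mul_le_mul_left h5 hpos

/-- Hardy--Littlewood type Tauberian theorem: if `‖T ^ (j + 1) - T ^ j‖ = O(1 / j)`, then the powers
of `T` stay at bounded distance from its Abel means. -/
lemma norm_pow_sub_abel_mean_le [CompleteSpace A] {T : A} {C : ℝ}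
    (hT : ∀ j : ℕ, ‖(T - 1) * T ^ j‖ ≤ C / (j + 1)) {N : ℕ} (hN : 1 ≤ N)
    (hu : IsUnit (1 - (N : ℂ) • (T - 1))) :
    ‖T ^ N - Ring.inverse (1 - (N : ℂ) • (T - 1))‖ ≤ 2 * C := by
  have hC : 0 ≤ C := by simpa using (norm_nonneg _).trans (hT 0)
  have hN0 : (0 : ℝ) < N := by exact_mod_cast hN
  set r : ℝ := N / (N + 1) with hr
  have hr0 : 0 ≤ r := by positivity
  have hr1 : r < 1 := by rw [hr, div_lt_one (by positivity)]; linarith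
  have h1r : 1 - r = ((N : ℝ) + 1)⁻¹ := by rw [hr]; field_simp; ring
  set d : ℕ → ℝ := fun n => if n < N then ∑ j ∈ Finset.Ico n N, C / ((j : ℝ) + 1) else 0 with hd
  have hdiff : ∀ n : ℕ, ‖T ^ N - T ^ n‖ ≤ d n + C / N * n := by
    intro n
    by_cases h : n < N
    · simp only [hd, h, if_true]
      exact (norm_pow_sub_pow_le hT h.le).trans (le_add_of_nonneg_right (by positivity))
    · push Not at h
      simp only [hd, h.not_gt, if_false, zero_add]
      rw [norm_sub_rev]
      refine (norm_pow_sub_pow_le hT h).trans ?_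
      calc ∑ j ∈ Finset.Ico N n, C / ((j : ℝ) + 1) ≤ ∑ j ∈ Finset.Ico N n, C / N := by
            refine Finset.sum_le_sum fun j hj => ?_
            have : (N : ℝ) ≤ j := by exact_mod_cast (Finset.mem_Ico.1 hj).1
            exact div_le_div_of_nonneg_left hC hN0 (by linarith)
        _ = ((n - N : ℕ) : ℝ) * (C / N) := by simp
        _ ≤ n * (C / N) := by
            refine mul_le_mul_of_nonneg_right ?_ (by positivity)
            exact_mod_cast Nat.sub_le n N
        _ = C / N * n := mul_comm _ _
  have hcoe : HasSum (fun n : ℕ => (n : ℝ) * r ^ n) (r / (1 - r) ^ 2) :=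
    hasSum_coe_mul_geometric_of_norm_lt_one (by rwa [Real.norm_of_nonneg hr0])
  have hdsum : HasSum (fun n : ℕ => r ^ n * d n) (∑ n ∈ Finset.range N, r ^ n * d n) :=
    hasSum_sum_of_ne_finset_zero fun n hn => by
      simp only [Finset.mem_range] at hn
      simp [hd, hn]
  have hd_le : ∑ n ∈ Finset.range N, r ^ n * d n ≤ C * N := by
    calc ∑ n ∈ Finset.range N, r ^ n * d n
        ≤ ∑ n ∈ Finset.range N, ∑ j ∈ Finset.Ico n N, C / ((j : ℝ) + 1) := by
          refine Finset.sum_le_sum fun n hn => ?_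
          simp only [hd, Finset.mem_range.1 hn, if_true]
          exact mul_le_of_le_one_left (Finset.sum_nonneg fun j _ => by positivity)
            (pow_le_one₀ hr0 hr1.le)
      _ = ∑ j ∈ Finset.range N, ∑ n ∈ Finset.range (j + 1), C / ((j : ℝ) + 1) := by
          refine Finset.sum_comm' fun n j => ?_
          simp only [Finset.mem_range, Finset.mem_Ico]
          omega
      _ = ∑ j ∈ Finset.range N, C := by
          refine Finset.sum_congr rfl fun j _ => ?_
          have : (j : ℝ) + 1 ≠ 0 := by positivity
          rw [Finset.sum_const, Finset.card_range, nsmul_eq_mul]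
          push_cast
          field_simp
      _ = C * N := by simp [mul_comm]
  have hmaj : HasSum (fun n : ℕ => r ^ n * d n + C / N * (n * r ^ n))
      (∑ n ∈ Finset.range N, r ^ n * d n + C / N * (r / (1 - r) ^ 2)) :=
    hdsum.add (hcoe.mul_left _)
  have hterm : ∀ n : ℕ, ‖(r : ℂ) ^ n • (T ^ N - T ^ n)‖ ≤ r ^ n * d n + C / N * (n * r ^ n) := by
    intro n
    rw [norm_smul, norm_pow, Complex.norm_of_nonneg hr0]
    calc r ^ n * ‖T ^ N - T ^ n‖ ≤ r ^ n * (d n + C / N * n) :=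
          mul_le_mul_of_nonneg_left (hdiff n) (by positivity)
      _ = _ := by ring
  have hs : Summable fun n : ℕ => (r : ℂ) ^ n • (T ^ N - T ^ n) :=
    hmaj.summable.of_norm_bounded hterm
  have hgeoC : HasSum (fun n : ℕ => (r : ℂ) ^ n) (1 - (r : ℂ))⁻¹ :=
    hasSum_geometric_of_norm_lt_one (by rwa [Complex.norm_of_nonneg hr0])
  have hconst : HasSum (fun n : ℕ => (r : ℂ) ^ n • T ^ N) ((1 - (r : ℂ))⁻¹ • T ^ N) :=
    hgeoC.smul_const _
  have hpow : Summable fun n : ℕ => ((r : ℂ) • T) ^ n := by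
    refine (hconst.summable.sub hs).congr fun n => ?_
    rw [smul_pow, smul_sub]
    abel
  have hN1 : (N : ℂ) + 1 ≠ 0 := by exact_mod_cast Nat.succ_ne_zero N
  have h1rC : (1 - (r : ℂ))⁻¹ = (N : ℂ) + 1 := by
    have : (1 : ℂ) - r = ((1 - r : ℝ) : ℂ) := by push_cast; ring
    rw [this, h1r]
    push_cast
    rw [inv_inv]
  have hfac : 1 - (N : ℂ) • (T - 1) = ((N : ℂ) + 1) • (1 - (r : ℂ) • T) := by
    rw [smul_sub, smul_sub, smul_smul, hr]
    push_cast
    rw [mul_div_cancel₀ _ hN1, add_smul, one_smul]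
    abel
  have hinv : ((N : ℂ) + 1) • Ring.inverse (1 - (N : ℂ) • (T - 1)) =
      ∑' n : ℕ, ((r : ℂ) • T) ^ n := by
    refine (left_inv_eq_right_inv hpow.tsum_pow_mul_one_sub ?_).symm
    rw [mul_smul_comm, ← smul_mul_assoc, ← hfac, Ring.mul_inverse_cancel _ hu]
  have hmain : ((N : ℂ) + 1) • (T ^ N - Ring.inverse (1 - (N : ℂ) • (T - 1))) =
      ∑' n : ℕ, (r : ℂ) ^ n • (T ^ N - T ^ n) := by
    rw [smul_sub, hinv, ← h1rC, ← hconst.tsum_eq, ← hconst.summable.tsum_sub hpow]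
    simp only [smul_pow, smul_sub]
  have hbound := tsum_of_norm_bounded hmaj hterm
  rw [← hmain, norm_smul] at hbound
  have hnorm : ‖(N : ℂ) + 1‖ = (N : ℝ) + 1 := by
    have : (N : ℂ) + 1 = ((N + 1 : ℕ) : ℂ) := by push_cast; rfl
    rw [this, Complex.norm_natCast]
    push_cast
    rfl
  have h2 : C / N * (r / (1 - r) ^ 2) = C * (N + 1) := by
    rw [h1r, hr]
    field_simp
  rw [hnorm, h2] at hbound
  have h3 : ((N : ℝ) + 1) * ‖T ^ N - Ring.inverse (1 - (N : ℂ) • (T - 1))‖ ≤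
      ((N : ℝ) + 1) * (2 * C) := by nlinarith
  exact le_of_mul_le_mul_left h3 (by positivity)

/-- The powers of a Ritt element stay bounded under a small rotation or dilation of `T - 1`. -/
lemma norm_add_smul_sub_one_pow_le {T : A} {M C : ℝ} (hM : ∀ n : ℕ, ‖T ^ n‖ ≤ M)
    (hT : ∀ j : ℕ, ‖(T - 1) * T ^ j‖ ≤ C / (j + 1)) {ε : ℂ}
    (hε : ‖ε‖ * (2 * C * Real.exp 1) ≤ 1 / 2) (n : ℕ) :
    ‖(ε • (T - 1) + T) ^ n‖ ≤ 2 * M := by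
  have hC : 0 ≤ C := by simpa using (norm_nonneg _).trans (hT 0)
  have hM0 : 0 ≤ M := (norm_nonneg _).trans (hM 0)
  have hcomm : Commute (ε • (T - 1)) T :=
    ((Commute.refl T).sub_left (Commute.one_left T)).smul_left ε
  rw [hcomm.add_pow]
  calc ‖∑ k ∈ Finset.range (n + 1), (ε • (T - 1)) ^ k * T ^ (n - k) * (n.choose k : A)‖
      ≤ ∑ k ∈ Finset.range (n + 1), M * (1 / 2 : ℝ) ^ k := by
        refine (norm_sum_le _ _).trans (Finset.sum_le_sum fun k hk => ?_)
        have hkn : k ≤ n := Nat.lt_succ_iff.1 (Finset.mem_range.1 hk)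
        have h1 : (ε • (T - 1)) ^ k * T ^ (n - k) * (n.choose k : A) =
            (ε ^ k * (n.choose k : ℂ)) • ((T - 1) ^ k * T ^ (n - k)) := by
          rw [smul_pow, smul_mul_assoc, smul_mul_assoc, mul_smul, ← nsmul_eq_mul',
            Nat.cast_smul_eq_nsmul]
        rw [h1, norm_smul, norm_mul, norm_pow, Complex.norm_natCast, mul_assoc]
        calc ‖ε‖ ^ k * ((n.choose k : ℝ) * ‖(T - 1) ^ k * T ^ (n - k)‖)
            ≤ ‖ε‖ ^ k * (M * (2 * C * Real.exp 1) ^ k) :=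
              mul_le_mul_of_nonneg_left
                (choose_mul_norm_sub_one_pow_mul_pow_le hM hT hkn) (by positivity)
          _ = M * (‖ε‖ * (2 * C * Real.exp 1)) ^ k := by rw [mul_pow]; ring
          _ ≤ M * (1 / 2 : ℝ) ^ k := by gcongr
    _ = M * ∑ k ∈ Finset.range (n + 1), (1 / 2 : ℝ) ^ k := by rw [Finset.mul_sum]
    _ ≤ M * 2 := mul_le_mul_of_nonneg_left (sum_geometric_two_le _) hM0
    _ = 2 * M := mul_comm _ _

end NormedAlgebra

section Quasinilpotent

variable {X : Type*} [NormedAddCommGroup X] [NormedSpace ℂ X] {Q : X →L[ℂ] X}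

lemma IsQuasinilpotent.isUnit_one_sub_smul (hQ : IsQuasinilpotent Q) (w : ℂ) :
    IsUnit (1 - w • Q) := by
  rcases eq_or_ne w 0 with rfl | hw
  · simp
  have h1 : w⁻¹ ∉ spectrum ℂ Q := by
    rw [hQ]
    simpa using hw
  rw [spectrum.notMem_iff] at h1
  have h2 : 1 - w • Q = algebraMap ℂ (X →L[ℂ] X) w * (algebraMap ℂ (X →L[ℂ] X) w⁻¹ - Q) := by
    rw [mul_sub, ← map_mul, mul_inv_cancel₀ hw, map_one, Algebra.smul_def]
  rw [h2]
  exact ((IsUnit.mk0 w hw).map _).mul h1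

lemma exists_norm_pow_le_of_mem_powerBoundedSet {z : ℂ} (hz : z ∈ powerBoundedSet Q) :
    ∃ N : ℝ, ∀ n : ℕ, ‖(1 + z • Q) ^ n‖ ≤ N := by
  obtain ⟨N, hN⟩ := hz
  refine ⟨max N ‖(1 : X →L[ℂ] X)‖, fun n => ?_⟩
  rcases Nat.eq_zero_or_pos n with rfl | hn
  · rw [pow_zero]
    exact le_max_right _ _
  · exact (hN n hn).trans (le_max_left _ _)

lemma zero_mem_powerBoundedSet : (0 : ℂ) ∈ powerBoundedSet Q :=
  ⟨‖(1 : X →L[ℂ] X)‖, fun j _ => by simp⟩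

lemma mem_abelSet_of_forall_le {z : ℂ} {K : ℝ}
    (h : ∀ s : ℝ, 0 ≤ s → ‖Ring.inverse (1 - ((s : ℂ) * z) • Q)‖ ≤ K) : z ∈ abelSet Q := by
  refine lt_of_le_of_lt (limsup_le_of_le (h := ?_)) (ENNReal.ofReal_lt_top (r := K))
  filter_upwards [eventually_ge_atTop 0] with s hs
  rw [pow_one]
  exact ENNReal.ofReal_le_ofReal (h s hs)

lemma exists_forall_nat_norm_inverse_le_of_mem_abelSet {z : ℂ} (hz : z ∈ abelSet Q) :
    ∃ K : ℝ, ∀ᶠ n : ℕ in atTop, ‖Ring.inverse (1 - ((n : ℂ) * z) • Q)‖ ≤ K := by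
  simp only [abelSet, abelSetOfOrder, Set.mem_ofPred_eq] at hz
  obtain ⟨c, hzc, hc⟩ := exists_between hz
  refine ⟨c.toReal, ?_⟩
  have h := tendsto_natCast_atTop_atTop.eventually (eventually_lt_of_limsup_lt hzc)
  filter_upwards [h] with n hn
  rw [pow_one] at hn
  simpa using (ENNReal.ofReal_le_iff_le_toReal hc.ne).1 hn.le

lemma zero_mem_abelSet : (0 : ℂ) ∈ abelSet Q :=
  mem_abelSet_of_forall_le (K := ‖(1 : X →L[ℂ] X)‖) fun s _ => by simp

lemma zero_mem_tauberianSet : (0 : ℂ) ∈ tauberianSet Q := by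
  simp only [tauberianSet, tauberianSetOfExponent, Set.mem_ofPred_eq, zero_smul, zero_mul,
    norm_zero, mul_zero, ENNReal.ofReal_zero, limsup_const, ENNReal.zero_lt_top]

lemma exists_bound_of_eventually_le {f : ℕ → ℝ} {K : ℝ} (h : ∀ᶠ n in atTop, f n ≤ K) :
    ∃ C, ∀ n, f n ≤ C := by
  obtain ⟨m, hm⟩ := eventually_atTop.1 h
  obtain ⟨C, hC⟩ := ((Set.finite_lt_nat m).image f).bddAbove
  refine ⟨max C K, fun n => ?_⟩
  rcases lt_or_ge n m with hn | hn
  · exact (hC ⟨n, hn, rfl⟩).trans (le_max_left _ _)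
  · exact (hm n hn).trans (le_max_right _ _)

lemma exists_norm_mul_pow_le_of_mem_tauberianSet {z : ℂ} (hz : z ∈ tauberianSet Q) :
    ∃ C : ℝ, ∀ j : ℕ, ‖(z • Q) * (1 + z • Q) ^ j‖ ≤ C / (j + 1) := by
  simp only [tauberianSet, tauberianSetOfExponent, Set.mem_ofPred_eq] at hz
  obtain ⟨c, hzc, hc⟩ := exists_between hz
  have h : ∀ᶠ j : ℕ in atTop, ((j : ℝ) + 1) * ‖(z • Q) * (1 + z • Q) ^ j‖ ≤ c.toReal := by
    filter_upwards [eventually_lt_of_limsup_lt hzc] with j hj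
    rw [Real.rpow_one] at hj
    exact (ENNReal.ofReal_le_iff_le_toReal hc.ne).1 hj.le
  obtain ⟨C, hC⟩ := exists_bound_of_eventually_le h
  refine ⟨C, fun j => ?_⟩
  rw [le_div_iff₀ (by positivity), mul_comm]
  exact hC j

lemma mem_interior_powerBoundedSet_of_mem_tauberianSet {z : ℂ} (hz0 : z ≠ 0)
    (hB : z ∈ powerBoundedSet Q) (hT : z ∈ tauberianSet Q) :
    z ∈ interior (powerBoundedSet Q) := by
  obtain ⟨M, hM⟩ := exists_norm_pow_le_of_mem_powerBoundedSet hB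
  obtain ⟨C, hC⟩ := exists_norm_mul_pow_le_of_mem_tauberianSet hT
  have hlim : Tendsto (fun w : ℂ => ‖(w - z) / z‖ * (2 * C * Real.exp 1)) (𝓝 z) (𝓝 0) := by
    have h1 : Continuous fun w : ℂ => ‖(w - z) / z‖ * (2 * C * Real.exp 1) := by fun_prop
    simpa using h1.tendsto z
  rw [mem_interior_iff_mem_nhds]
  filter_upwards [hlim.eventually (gt_mem_nhds one_half_pos)] with w hw
  refine ⟨2 * M, fun n _ => ?_⟩
  have hC' : ∀ j : ℕ, ‖((1 + z • Q) - 1) * (1 + z • Q) ^ j‖ ≤ C / (j + 1) := by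
    simpa only [add_sub_cancel_left] using hC
  have h := norm_add_smul_sub_one_pow_le hM hC' hw.le n
  have heq : ((w - z) / z) • ((1 + z • Q) - 1) + (1 + z • Q) = 1 + w • Q := by
    rw [add_sub_cancel_left, smul_smul, div_mul_cancel₀ _ hz0, sub_smul]
    abel
  rwa [heq] at h

variable [CompleteSpace X]

/-- The open half-plane around a nonzero point of the power-bounded set is contained in the
Abel set. -/
lemma mem_abelSet_of_re_div_pos (hQ : IsQuasinilpotent Q) {z w : ℂ} (hz : z ∈ powerBoundedSet Q)
    (hz0 : z ≠ 0) (hw : 0 < (w / z).re) : w ∈ abelSet Q := by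
  obtain ⟨N, hN⟩ := exists_norm_pow_le_of_mem_powerBoundedSet hz
  refine mem_abelSet_of_forall_le (K := N * (‖w / z‖ / (w / z).re)) fun s hs => ?_
  have hK : 1 ≤ ‖w / z‖ / (w / z).re := by
    rw [one_le_div hw]
    exact Complex.re_le_norm _
  have h1 : ((s : ℂ) * w) • Q = ((s : ℂ) * (w / z)) • (z • Q) := by
    rw [smul_smul, mul_assoc, div_mul_cancel₀ _ hz0]
  rw [h1]
  refine norm_inverse_one_sub_smul_le hN hK ?_ (h1 ▸ hQ.isUnit_one_sub_smul _)
  rw [norm_mul, Complex.norm_of_nonneg hs, Complex.re_ofReal_mul]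
  exact le_of_eq (by field_simp)

lemma closure_powerBoundedSet_subset_abelSet (hQ : IsQuasinilpotent Q) :
    closure (powerBoundedSet Q) ⊆ abelSet Q := by
  intro w hw
  rcases eq_or_ne w 0 with rfl | hw0
  · exact zero_mem_abelSet
  have hlim : Tendsto (fun z : ℂ => (w / z).re) (𝓝 w) (𝓝 1) := by
    have h1 : ContinuousAt (fun z : ℂ => (w / z).re) w :=
      Complex.continuous_re.continuousAt.comp (continuousAt_const.div continuousAt_id hw0)
    simpa [ContinuousAt, div_self hw0] using h1
  have hev : ∀ᶠ z in 𝓝 w, 0 < (w / z).re ∧ z ≠ 0 :=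
    (hlim.eventually (lt_mem_nhds one_pos)).and (isOpen_ne.mem_nhds hw0)
  obtain ⟨z, ⟨hre, hz0⟩, hz⟩ := mem_closure_iff_nhds.1 hw _ hev
  exact mem_abelSet_of_re_div_pos hQ hz hz0 hre

/-- Tauberian step: on the Tauberian set, Abel boundedness implies power boundedness. -/
lemma abelSet_inter_tauberianSet_subset (hQ : IsQuasinilpotent Q) :
    abelSet Q ∩ tauberianSet Q ⊆ powerBoundedSet Q := by
  rintro z ⟨hA, hT⟩
  obtain ⟨K, hK⟩ := exists_forall_nat_norm_inverse_le_of_mem_abelSet hA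
  obtain ⟨C, hC⟩ := exists_norm_mul_pow_le_of_mem_tauberianSet hT
  have hC' : ∀ j : ℕ, ‖((1 + z • Q) - 1) * (1 + z • Q) ^ j‖ ≤ C / (j + 1) := by
    simpa only [add_sub_cancel_left] using hC
  have hev : ∀ᶠ n : ℕ in atTop, ‖(1 + z • Q) ^ n‖ ≤ 2 * C + K := by
    filter_upwards [hK, eventually_ge_atTop 1] with n hn hn1
    have hu : IsUnit (1 - (n : ℂ) • ((1 + z • Q) - 1)) := by
      rw [add_sub_cancel_left, smul_smul]
      exact hQ.isUnit_one_sub_smul _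
    have h := norm_pow_sub_abel_mean_le hC' hn1 hu
    rw [add_sub_cancel_left, smul_smul] at h
    exact (norm_le_norm_sub_add _ _).trans (add_le_add h hn)
  obtain ⟨N, hN⟩ := exists_bound_of_eventually_le hev
  exact ⟨N, fun j _ => hN j⟩

/-- If `0` is interior to the power-bounded set, the resolvent is a bounded entire function. -/
lemma eq_zero_of_zero_mem_interior_powerBoundedSet (hQ : IsQuasinilpotent Q)
    (h0 : (0 : ℂ) ∈ interior (powerBoundedSet Q)) : Q = 0 := by
  obtain ⟨δ, hδ, hball⟩ := Metric.mem_nhds_iff.1 (mem_interior_iff_mem_nhds.1 h0)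
  have hmem : ∀ a : ℂ, ‖a‖ = 1 → ∃ N : ℝ, ∀ w : ℂ, ‖w / a‖ ≤ 2 * (w / a).re →
      ‖Ring.inverse (1 - w • Q)‖ ≤ N := by
    intro a ha
    have ha0 : a ≠ 0 := by
      rintro rfl
      simp at ha
    have hd0 : ((δ / 2 : ℝ) : ℂ) ≠ 0 := by exact_mod_cast (half_pos hδ).ne'
    have hz : ((δ / 2 : ℝ) : ℂ) * a ∈ powerBoundedSet Q := by
      apply hball
      rw [mem_ball_zero_iff, norm_mul, ha, Complex.norm_of_nonneg (half_pos hδ).le, mul_one]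
      exact half_lt_self hδ
    obtain ⟨N, hN⟩ := exists_norm_pow_le_of_mem_powerBoundedSet hz
    refine ⟨N * 2, fun w hw => ?_⟩
    have h1 : w • Q = (((δ / 2)⁻¹ : ℝ) * (w / a) : ℂ) • ((((δ / 2 : ℝ) : ℂ) * a) • Q) := by
      rw [smul_smul]
      congr 1
      rw [Complex.ofReal_inv]
      field_simp
    rw [h1]
    refine norm_inverse_one_sub_smul_le hN one_le_two ?_ (h1 ▸ hQ.isUnit_one_sub_smul _)
    have hd : 0 < (δ / 2)⁻¹ := inv_pos.2 (half_pos hδ)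
    rw [norm_mul, Complex.norm_of_nonneg hd.le, Complex.re_ofReal_mul]
    nlinarith
  obtain ⟨N₁, h₁⟩ := hmem 1 (by simp)
  obtain ⟨N₂, h₂⟩ := hmem (-1) (by simp)
  obtain ⟨N₃, h₃⟩ := hmem Complex.I (by simp)
  obtain ⟨N₄, h₄⟩ := hmem (-Complex.I) (by simp)
  have hbdd : ∀ w : ℂ, ‖Ring.inverse (1 - w • Q)‖ ≤ max (max N₁ N₂) (max N₃ N₄) := by
    intro w
    have hw := Complex.norm_le_abs_re_add_abs_im w
    have hor : (‖w‖ ≤ 2 * w.re ∨ ‖w‖ ≤ 2 * -w.re) ∨ (‖w‖ ≤ 2 * w.im ∨ ‖w‖ ≤ 2 * -w.im) := by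
      rcases le_total |w.re| |w.im| with h | h
      · right
        rcases abs_choice w.im with h' | h' <;> rw [h'] at h hw
        · left; linarith
        · right; linarith
      · left
        rcases abs_choice w.re with h' | h' <;> rw [h'] at h hw
        · left; linarith
        · right; linarith
    rcases hor with (h | h) | (h | h)
    · exact (h₁ w (by simpa using h)).trans (by simp)
    · exact (h₂ w (by simpa [div_neg] using h)).trans (by simp)
    · exact (h₃ w (by simpa using h)).trans (by simp)
    · exact (h₄ w (by simpa [div_neg] using h)).trans (by simp)
  have hdiff : Differentiable ℂ fun w : ℂ => Ring.inverse (1 - w • Q) :=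
    Differentiable.inverse (by fun_prop) hQ.isUnit_one_sub_smul
  have hb : Bornology.IsBounded (Set.range fun w : ℂ => Ring.inverse (1 - w • Q)) := by
    rw [isBounded_iff_forall_norm_le]
    exact ⟨_, by rintro _ ⟨w, rfl⟩; exact hbdd w⟩
  have h1 : Ring.inverse (1 - (1 : ℂ) • Q) = Ring.inverse (1 - (0 : ℂ) • Q) :=
    hdiff.apply_eq_apply_of_bounded hb 1 0
  have h2 := Ring.mul_inverse_cancel _ (hQ.isUnit_one_sub_smul 1)
  rw [h1, zero_smul, sub_zero, Ring.inverse_one, mul_one, one_smul] at h2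
  simpa using h2

end Quasinilpotent

end Microspectral

theorem proposition3p4 {X : Type*} [NormedAddCommGroup X] [NormedSpace ℂ X] [CompleteSpace X]
    (Q : X →L[ℂ] X) (hQ : Microspectral.IsQuasinilpotent Q) :
    closure (Microspectral.powerBoundedSet Q) ⊆ Microspectral.abelSet Q ∧
      (Q ≠ 0 →
        frontier (Microspectral.powerBoundedSet Q) ∩ Microspectral.tauberianSet Q = {0}) := by
  refine ⟨Microspectral.closure_powerBoundedSet_subset_abelSet hQ, fun hQ0 => ?_⟩
  refine Set.Subset.antisymm ?_ ?_
  · rintro z ⟨⟨hcl, hint⟩, hT⟩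
    by_contra hz0
    have hA := Microspectral.closure_powerBoundedSet_subset_abelSet hQ hcl
    have hB := Microspectral.abelSet_inter_tauberianSet_subset hQ ⟨hA, hT⟩
    exact hint (Microspectral.mem_interior_powerBoundedSet_of_mem_tauberianSet hz0 hB hT)
  · rintro _ rfl
    refine ⟨⟨subset_closure Microspectral.zero_mem_powerBoundedSet, fun h => hQ0 ?_⟩,
      Microspectral.zero_mem_tauberianSet⟩
    exact Microspectral.eq_zero_of_zero_mem_interior_powerBoundedSet hQ h
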